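/- Let $m\in\mathbb N$, let $\theta\in\mathbb R^m$ and $\delta>0$ be such that the open Euclidean ball $B(\theta,\delta)$ is contained in $[0,1]^m$, put $K=\sum_{i=1}^m\theta_i$, and let $q_1,\dots,q_m\in(0,\infty]$ satisfy $\sum_{i=1}^m \frac1{q_i}\ge 1$ (with $1/\infty=0$). Then there is a constant $C$, depending only on $\theta$, $(q_1,\dots,q_m)$, $m$ and $\delta$, with the following property. Let $\ell\ge 0$ and let $\Lambda$ be a (real or complex) multilinear form defined at least on $(L^1(\mathbb R^\ell)\cap L^\infty(\mathbb R^\ell))^m$, and suppose that for some $A\ge 0$ $$|\Lambda(a_1,\dots,a_m)|\le A\prod_{i=1}^m\|a_i\|_{L^{1/\eta_i}(\mathbb R^\ell)}$$ for all $a_1,\dots,a_m\in L^1(\mathbb R^\ell)\cap L^\infty(\mathbb R^\ell)$ and all $\eta\in B(\theta,\delta)$ with $\sum_{i=1}^m\eta_i=K$. Then $$|\Lambda(a_1,\dots,a_m)|\le C\,A\prod_{i=1}^m\|a_i\|_{L^{1/\theta_i,q_i}(\mathbb R^\ell)}$$ for all $a_1,\dots,a_m\in L^1(\mathbb R^\ell)\cap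 L^\infty(\mathbb R^\ell)$. Here $\|f\|_{L^{p,q}}=\left(\int_0^\infty (t^{1/p}f^*(t))^q\,\frac{dt}{t}\right)^{1/q}$ for $q<\infty$ and $\|f\|_{L^{p,\infty}}=\sup_{t>0}t^{1/p}f^*(t)$, where $f^*(t)=\inf\{s\ge 0: |\{|f|>s\}|\le t\}$ is the decreasing rearrangement of $f$. -/

import Mathlib

open MeasureTheory
open scoped ENNReal NNReal

noncomputable section

/-- The decreasing rearrangement `f*(t) = inf {s ≥ 0 : μ {|f| > s} ≤ t}`. -/
def decreasingRearrangement {α E : Type*} [MeasurableSpace α] [ENorm E]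
    (f : α → E) (μ : Measure α) (t : ℝ≥0∞) : ℝ≥0∞ :=
  sInf {s : ℝ≥0∞ | μ {x | s < ‖f x‖ₑ} ≤ t}

/-- The Lorentz quasi-norm of `L^{p,q}(μ)` for `0 < p < ∞` and `0 < q ≤ ∞`:
`(∫_0^∞ (t^{1/p} f*(t))^q dt/t)^{1/q}` if `q < ∞`, and `sup_{t > 0} t^{1/p} f*(t)` if `q = ∞`. -/
def eLorentzNorm {α E : Type*} [MeasurableSpace α] [ENorm E]
    (f : α → E) (p : ℝ) (q : ℝ≥0∞) (μ : Measure α) : ℝ≥0∞ :=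
  if q = ∞ then
    ⨆ t ∈ Set.Ioi (0 : ℝ),
      ENNReal.ofReal (t ^ (1 / p)) * decreasingRearrangement f μ (ENNReal.ofReal t)
  else
    (∫⁻ t in Set.Ioi (0 : ℝ),
      (ENNReal.ofReal (t ^ (1 / p)) * decreasingRearrangement f μ (ENNReal.ofReal t)) ^ q.toReal
        / ENNReal.ofReal t) ^ (1 / q.toReal)

/-- The space `L¹(ℝ^ℓ) ∩ L^∞(ℝ^ℓ)` of (classes of) `𝕜`-valued functions. -/
abbrev L1Linf (𝕜 : Type*) [RCLike 𝕜] (ℓ : ℕ) :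
    Submodule 𝕜 (EuclideanSpace ℝ (Fin ℓ) →ₘ[volume] 𝕜) :=
  Lp.LpSubmodule 𝕜 𝕜 1 volume ⊓ Lp.LpSubmodule 𝕜 𝕜 ∞ volume

end

/-! ### Level sets and the decreasing rearrangement. -/

section Rearrangement

variable {α E : Type*} [MeasurableSpace α] {μ : Measure α}

/-! Cut each a_i into pieces of modulus between a_i*(2^(k+1)) and a_i*(2^k). Such a piece lives on a
set of measure at most 2^(k+1), so its L^{1/η} norm is at most 2^((k+1)η) a_i*(2^k)
(`L1Linf.eLpNorm_dyadicPiece_le`). Each multi-index k may use the hypothesis with its own η: moving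
ε from the coordinate where k is largest to the one where it is smallest keeps ∑ η_i and gains
2^(-ε(max k - min k)) over η = θ (`exists_mem_ball_sum_mul_eq`).

So Λ is controlled by a sum of products of b_i(k_i) = 2^(k_i θ_i) a_i*(2^(k_i)), damped
geometrically off the diagonal. The ℓ^{q_i} norm of b_i is at most a constant times the Lorentz
norm, and since ∑ 1/q_i ≥ 1 a discrete Hölder inequality sums the products
(`sum_mul_prod_le_of_sum_rpow_le`).

This bounds Λ on truncations, uniformly in the truncation. They converge to a_i in L^{1/θ_i}, and
the hypothesis at η = θ lets Λ pass to the limit (`enorm_map_le_of_forall_enorm_map_middle_le`). -/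

theorem decreasingRearrangement_antitone [ENorm E] (f : α → E) :
    Antitone (decreasingRearrangement f μ) := fun _ _ h =>
  sInf_le_sInf fun _ hs => le_trans hs h

/-- The infimum defining f*(t) is attained: along heights decreasing to it the superlevel sets
increase, and measure is continuous from below. -/
theorem measure_decreasingRearrangement_lt_le [ENorm E] (f : α → E) (t : ℝ≥0∞) :
    μ {x | decreasingRearrangement f μ t < ‖f x‖ₑ} ≤ t := by
  obtain ⟨u, hu, hlim, hmem⟩ := exists_seq_tendsto_sInf
    (S := {s : ℝ≥0∞ | μ {x | s < ‖f x‖ₑ} ≤ t}) ⟨∞, by simp⟩ (OrderBot.bddBelow _)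
  have hU : {x | decreasingRearrangement f μ t < ‖f x‖ₑ} ⊆ ⋃ n, {x | u n < ‖f x‖ₑ} := by
    intro x hx
    obtain ⟨n, hn⟩ := (hlim.eventually_lt_const hx).exists
    exact Set.mem_iUnion.2 ⟨n, hn⟩
  have hmono : Monotone fun n => {x | u n < ‖f x‖ₑ} := fun _ _ h _ hx => lt_of_le_of_lt (hu h) hx
  calc _ ≤ μ (⋃ n, {x | u n < ‖f x‖ₑ}) := measure_mono hU
    _ = ⨆ n, μ {x | u n < ‖f x‖ₑ} := hmono.measure_iUnion
    _ ≤ t := iSup_le hmem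

theorem ae_exists_le_decreasingRearrangement [ENorm E] (f : α → E) {u : ℕ → ℝ≥0∞}
    (hu : Filter.Tendsto u Filter.atTop (nhds 0)) :
    ∀ᵐ x ∂μ, ∃ n, ‖f x‖ₑ ≤ decreasingRearrangement f μ (u n) := by
  rw [ae_iff]
  refine le_antisymm (ge_of_tendsto' hu fun n => ?_) bot_le
  refine le_trans (measure_mono fun x hx => ?_) (measure_decreasingRearrangement_lt_le f (u n))
  simp only [Set.mem_ofPred_eq, not_exists, not_le] at hx
  exact hx n

theorem eventually_decreasingRearrangement_lt [NormedAddCommGroup E] {f : α → E}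
    (hf : MemLp f 1 μ) {u : ℕ → ℝ≥0∞} (hu : Filter.Tendsto u Filter.atTop (nhds ∞)) {x : α}
    (hx : f x ≠ 0) : ∀ᶠ n in Filter.atTop, decreasingRearrangement f μ (u n) < ‖f x‖ₑ := by
  -- Half the height gives a level set of finite measure and leaves room for the strict inequality.
  have h0 : ‖f x‖ₑ / 2 ≠ 0 := by simp [hx]
  have hfin := hf.meas_ge_lt_top'_enorm one_ne_zero ENNReal.one_ne_top h0 (by simp)
  filter_upwards [hu.eventually_const_lt hfin] with n hn
  refine lt_of_le_of_lt (sInf_le (a := ‖f x‖ₑ / 2) ?_)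
    (ENNReal.half_lt_self (by simpa using hx) enorm_ne_top)
  rw [Set.mem_ofPred_eq]
  exact le_trans (measure_mono fun y (hy : ‖f x‖ₑ / 2 < ‖f y‖ₑ) => hy.le) hn.le

end Rearrangement

/-! ### Real powers of two in `ℝ≥0∞`. -/

section TwoPow

theorem two_rpow_ne_top (x : ℝ) : (2 : ℝ≥0∞) ^ x ≠ ∞ := by
  simp [ENNReal.rpow_eq_top_iff]

theorem ofReal_two_rpow (x : ℝ) : ENNReal.ofReal ((2 : ℝ) ^ x) = (2 : ℝ≥0∞) ^ x := by
  rw [← ENNReal.ofReal_rpow_of_pos two_pos]; simp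

theorem two_rpow_add (x y : ℝ) : (2 : ℝ≥0∞) ^ (x + y) = 2 ^ x * 2 ^ y :=
  ENNReal.rpow_add _ _ two_ne_zero ENNReal.ofNat_ne_top

theorem prod_two_rpow {ι : Type*} (s : Finset ι) (x : ι → ℝ) :
    ∏ i ∈ s, (2 : ℝ≥0∞) ^ x i = 2 ^ ∑ i ∈ s, x i := by
  classical
  induction s using Finset.induction_on with
  | empty => simp
  | insert a s ha ih => rw [Finset.prod_insert ha, Finset.sum_insert ha, two_rpow_add, ih]

theorem tendsto_two_rpow_natCast :
    Filter.Tendsto (fun n : ℕ => (2 : ℝ≥0∞) ^ (n : ℝ)) Filter.atTop (nhds ∞) := by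
  simp only [ENNReal.rpow_natCast]
  exact ENNReal.tendsto_pow_atTop_nhds_top_iff.2 (by norm_num)

theorem tendsto_two_rpow_neg_natCast :
    Filter.Tendsto (fun n : ℕ => (2 : ℝ≥0∞) ^ (-(n : ℝ))) Filter.atTop (nhds 0) := by
  simp only [ENNReal.rpow_neg, ENNReal.rpow_natCast]
  simpa only [ENNReal.inv_pow] using
    ENNReal.tendsto_pow_atTop_nhds_zero_of_lt_one (r := 2⁻¹) (by simp)

end TwoPow

/-! ### Dyadic samples against the Lorentz norm. -/

section Lorentz

variable {α E : Type*} [MeasurableSpace α] {μ : Measure α} [ENorm E]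

/-- The dyadic samples `2^{k θ} f*(2^k)` of the weighted rearrangement `t ↦ t^θ f*(t)`. -/
noncomputable def dyadicRearrangement (f : α → E) (μ : Measure α) (θ : ℝ) (k : ℤ) : ℝ≥0∞ :=
  2 ^ (k * θ : ℝ) * decreasingRearrangement f μ (2 ^ (k : ℝ))

theorem dyadicRearrangement_le_eLorentzNorm_top (f : α → E) (θ : ℝ) (k : ℤ) :
    dyadicRearrangement f μ θ k ≤ eLorentzNorm f (1 / θ) ∞ μ := by
  rw [eLorentzNorm, if_pos rfl]
  refine le_trans (le_of_eq ?_) (le_iSup₂ (f := fun t (_ : t ∈ Set.Ioi (0 : ℝ)) =>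
    ENNReal.ofReal (t ^ (1 / (1 / θ))) * decreasingRearrangement f μ (ENNReal.ofReal t))
    ((2 : ℝ) ^ (k : ℝ)) (Set.mem_Ioi.2 (by positivity)))
  rw [dyadicRearrangement, one_div_one_div, ← Real.rpow_mul two_pos.le, ofReal_two_rpow,
    ofReal_two_rpow]

/-- On (2^(k-1), 2^k] one has f*(t) ≥ f*(2^k) and t^θ ≥ 2^((k-1)θ), which costs 2^θ; the dt/t mass
is at least 1/2, which costs 2^(1/q). -/
theorem dyadicRearrangement_rpow_le_setLIntegral (f : α → E) {θ q : ℝ} (hθ : 0 ≤ θ)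
    (hq : 0 < q) (k : ℤ) :
    (dyadicRearrangement f μ θ k) ^ q ≤ (2 ^ (θ + 1 / q)) ^ q *
      ∫⁻ t in Set.Ioc ((2 : ℝ) ^ (k - 1)) (2 ^ k),
        (ENNReal.ofReal (t ^ θ) * decreasingRearrangement f μ (ENNReal.ofReal t)) ^ q
          / ENNReal.ofReal t := by
  have hk : (0 : ℝ) < 2 ^ (k - 1) := by positivity
  have hvol : volume (Set.Ioc ((2 : ℝ) ^ (k - 1)) (2 ^ k)) = 2 ^ ((k : ℝ) - 1) := by
    rw [Real.volume_Ioc, ← ofReal_two_rpow]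
    congr 1
    rw [← Real.rpow_intCast, ← Real.rpow_intCast, show (k : ℝ) = 1 + ((k : ℝ) - 1) by ring,
      Real.rpow_add two_pos]
    push_cast
    rw [show 1 + ((k : ℝ) - 1) - 1 = (k : ℝ) - 1 by ring, Real.rpow_one]
    ring
  have hint : (2 ^ (((k : ℝ) - 1) * θ) * decreasingRearrangement f μ (2 ^ (k : ℝ))) ^ q
        / 2 ^ (k : ℝ) * 2 ^ ((k : ℝ) - 1) ≤
      ∫⁻ t in Set.Ioc ((2 : ℝ) ^ (k - 1)) (2 ^ k),
        (ENNReal.ofReal (t ^ θ) * decreasingRearrangement f μ (ENNReal.ofReal t)) ^ q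
          / ENNReal.ofReal t := by
    rw [← hvol, ← setLIntegral_const]
    refine setLIntegral_mono' measurableSet_Ioc fun t ht => ?_
    have ht2 : ENNReal.ofReal t ≤ 2 ^ (k : ℝ) := by
      rw [← ofReal_two_rpow, Real.rpow_intCast]
      exact ENNReal.ofReal_le_ofReal ht.2
    gcongr
    · rw [← ofReal_two_rpow, Real.rpow_mul two_pos.le]
      refine ENNReal.ofReal_le_ofReal (Real.rpow_le_rpow (by positivity) ?_ hθ)
      rw [← Int.cast_one, ← Int.cast_sub, Real.rpow_intCast]
      exact ht.1.le
    · exact decreasingRearrangement_antitone f ht2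
  refine le_trans (le_of_eq ?_) (mul_le_mul_right hint _)
  rw [dyadicRearrangement, ENNReal.mul_rpow_of_nonneg _ _ hq.le,
    ENNReal.mul_rpow_of_nonneg _ _ hq.le, ← ENNReal.rpow_mul, ← ENNReal.rpow_mul,
    ← ENNReal.rpow_mul, div_eq_mul_inv _ ((2 : ℝ≥0∞) ^ (k : ℝ)), ← ENNReal.rpow_neg]
  have h : (2 : ℝ≥0∞) ^ ((k : ℝ) * θ * q) = 2 ^ ((θ + 1 / q) * q) *
      (2 ^ (((k : ℝ) - 1) * θ * q) * 2 ^ (-(k : ℝ)) * 2 ^ ((k : ℝ) - 1)) := by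
    rw [← two_rpow_add, ← two_rpow_add, ← two_rpow_add]
    congr 1
    field_simp
    ring
  rw [h]
  ring

theorem sum_dyadicRearrangement_rpow_le (f : α → E) {θ : ℝ} (hθ : 0 ≤ θ) {q : ℝ≥0∞}
    (hq0 : 0 < q) (hq : q ≠ ∞) (s : Finset ℤ) :
    ∑ k ∈ s, (dyadicRearrangement f μ θ k) ^ q.toReal ≤
      (2 ^ (θ + 1 / q.toReal) * eLorentzNorm f (1 / θ) q μ) ^ q.toReal := by
  have hq' : 0 < q.toReal := ENNReal.toReal_pos hq0.ne' hq
  rw [eLorentzNorm, if_neg hq, ENNReal.mul_rpow_of_nonneg _ _ hq'.le,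
    ← ENNReal.rpow_mul (∫⁻ _ in _, _), one_div_mul_cancel hq'.ne', ENNReal.rpow_one,
    one_div_one_div]
  refine (Finset.sum_le_sum fun k _ =>
    dyadicRearrangement_rpow_le_setLIntegral f hθ hq' k).trans ?_
  rw [← Finset.mul_sum]
  gcongr
  have hmono : Monotone fun k : ℤ => (2 : ℝ) ^ k :=
    (zpow_right_strictMono₀ one_lt_two).monotone
  rw [← lintegral_biUnion_finset]
  · refine lintegral_mono_set (Set.iUnion₂_subset fun k _ t ht => ?_)
    exact lt_trans (by positivity) ht.1
  · have := hmono.pairwise_disjoint_on_Ioc_pred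
    exact this.set_pairwise _
  · exact fun _ _ => measurableSet_Ioc

end Lorentz

/-! ### A discrete Hölder–Young inequality. -/

section Discrete

theorem prod_rpow_eq_rpow_sum {ι : Type*} (s : Finset ι) (M : ℝ≥0∞) (x : ι → ℝ)
    (hx : ∀ i ∈ s, 0 ≤ x i) : ∏ i ∈ s, M ^ x i = M ^ ∑ i ∈ s, x i := by
  classical
  induction s using Finset.induction_on with
  | empty => simp
  | insert a s ha ih =>
    rw [Finset.prod_insert ha, Finset.sum_insert ha,
      ih fun i hi => hx i (Finset.mem_insert_of_mem hi),
      ENNReal.rpow_add_of_nonneg _ _ (hx a (Finset.mem_insert_self a s))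
        (Finset.sum_nonneg fun i hi => hx i (Finset.mem_insert_of_mem hi))]

/-- With M the right side, c_i ≤ M^(1/q_i), so the product is at most M^(∑ 1/q_i) ≤ M when M ≤ 1. If
M ≥ 1, then c_i ≤ 1 suffices. An index with q_i = ∞ has exponent 0 and adds nothing to M. -/
theorem prod_le_sum_rpow {ι : Type*} [Fintype ι] {q : ι → ℝ≥0∞} (hq0 : ∀ i, 0 < q i)
    (hq : 1 ≤ ∑ i, 1 / q i) {c : ι → ℝ≥0∞} (hc : ∀ i, c i ≤ 1) :
    ∏ i, c i ≤ ∑ i, if q i = ∞ then 0 else c i ^ (q i).toReal := by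
  set M := ∑ i, if q i = ∞ then 0 else c i ^ (q i).toReal with hM
  rcases le_total 1 M with h1 | h1
  · exact (Finset.prod_le_one' fun i _ => hc i).trans h1
  have hfin : ∀ i, 1 / q i ≠ ∞ := fun i => by simp [(hq0 i).ne']
  have hsum : 1 ≤ ∑ i, (1 / q i).toReal := by
    rw [← ENNReal.toReal_sum fun i _ => hfin i]
    exact (ENNReal.toReal_mono (ENNReal.sum_ne_top.2 fun i _ => hfin i) hq).trans_eq' (by simp)
  have hle : ∀ i, c i ≤ M ^ (1 / q i).toReal := by
    intro i
    by_cases hi : q i = ∞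
    · simpa [hi] using hc i
    have hpos : 0 < (q i).toReal := ENNReal.toReal_pos (hq0 i).ne' hi
    have : c i ^ (q i).toReal ≤ M := by
      refine le_trans (le_of_eq (by rw [if_neg hi])) (Finset.single_le_sum
        (f := fun i => if q i = ∞ then 0 else c i ^ (q i).toReal)
        (fun _ _ => zero_le) (Finset.mem_univ i))
    rw [one_div, ENNReal.toReal_inv]
    exact (ENNReal.le_rpow_inv_iff hpos).2 this
  calc ∏ i, c i ≤ ∏ i, M ^ (1 / q i).toReal := Finset.prod_le_prod' fun i _ => hle i
    _ = M ^ ∑ i, (1 / q i).toReal := prod_rpow_eq_rpow_sum _ _ _ fun _ _ => ENNReal.toReal_nonneg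
    _ ≤ M ^ (1 : ℝ) := ENNReal.rpow_le_rpow_of_exponent_ge h1 hsum
    _ = M := ENNReal.rpow_one M

theorem tsum_int_pow_natAbs_ne_top {r : ℝ≥0∞} (hr : r < 1) :
    ∑' n : ℤ, r ^ n.natAbs ≠ ∞ := by
  have h : (∑' n : ℕ, r ^ n) ≠ ∞ := by
    rw [ENNReal.tsum_geometric]
    simp [tsub_eq_zero_iff_le, hr]
  have hneg : (∑' n : ℕ, r ^ (n + 1)) ≠ ∞ := by
    simp only [pow_succ, ENNReal.tsum_mul_right]
    exact ENNReal.mul_ne_top h (hr.trans ENNReal.one_lt_top).ne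
  rw [tsum_of_nat_of_neg_add_one (f := fun n : ℤ => r ^ n.natAbs) ENNReal.summable
    ENNReal.summable]
  have : ∀ n : ℕ, (-((n : ℤ) + 1)).natAbs = n + 1 := fun n => by omega
  simp only [Int.natAbs_natCast, this]
  exact ENNReal.add_ne_top.2 ⟨h, hneg⟩

/-- Decoupling the pivot value n from k_i only enlarges the sum. The sum over k then factors into
one geometric series per coordinate, pivot included. -/
theorem sum_piFinset_mul_prod_le {ι : Type*} [Fintype ι] [DecidableEq ι] (S : Finset ℤ) (i : ι)
    (g : ℤ → ℝ≥0∞) (r : ℝ≥0∞) :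
    ∑ k ∈ Fintype.piFinset fun _ : ι => S, g (k i) * ∏ j, r ^ (k j - k i).natAbs ≤
      (∑ n ∈ S, g n) * (∑' n : ℤ, r ^ n.natAbs) ^ Fintype.card ι := by
  calc ∑ k ∈ Fintype.piFinset fun _ : ι => S, g (k i) * ∏ j, r ^ (k j - k i).natAbs
      ≤ ∑ k ∈ Fintype.piFinset fun _ : ι => S, ∑ n ∈ S, g n * ∏ j, r ^ (k j - n).natAbs := by
        refine Finset.sum_le_sum fun k hk => ?_
        exact Finset.single_le_sum (f := fun n => g n * ∏ j, r ^ (k j - n).natAbs)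
          (fun _ _ => zero_le) (Fintype.mem_piFinset.1 hk i)
    _ = ∑ n ∈ S, g n * ∏ _j : ι, ∑ l ∈ S, r ^ (l - n).natAbs := by
        rw [Finset.sum_comm]
        refine Finset.sum_congr rfl fun n _ => ?_
        rw [← Finset.mul_sum, Finset.prod_univ_sum]
    _ ≤ ∑ n ∈ S, g n * (∑' n : ℤ, r ^ n.natAbs) ^ Fintype.card ι := by
        gcongr with n
        rw [Finset.prod_const, Finset.card_univ]
        gcongr
        calc _ ≤ ∑' l : ℤ, r ^ (l - n).natAbs := ENNReal.sum_le_tsum S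
          _ = _ := (Equiv.subRight n).tsum_eq fun l : ℤ => r ^ l.natAbs
    _ = _ := by rw [Finset.sum_mul]

/-- A discrete Hölder–Young inequality: sums of products, damped off the diagonal, are controlled
by the product of `ℓ^{q_i}` bounds as soon as `∑ 1/q_i ≥ 1`. -/
theorem sum_mul_prod_le_of_sum_rpow_le {ι : Type*} [Fintype ι] [DecidableEq ι] {q : ι → ℝ≥0∞}
    (hq0 : ∀ i, 0 < q i) (hq : 1 ≤ ∑ i, 1 / q i) (S : Finset ℤ) {r : ℝ≥0∞}
    {W : (ι → ℤ) → ℝ≥0∞} (hW : ∀ k i, W k ≤ ∏ j, r ^ (k j - k i).natAbs)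
    {b : ι → ℤ → ℝ≥0∞} {B : ι → ℝ≥0∞}
    (htop : ∀ i, q i = ∞ → ∀ n, b i n ≤ B i)
    (hfin : ∀ i, q i ≠ ∞ → ∀ s : Finset ℤ, ∑ n ∈ s, b i n ^ (q i).toReal ≤ B i ^ (q i).toReal) :
    ∑ k ∈ Fintype.piFinset fun _ : ι => S, W k * ∏ i, b i (k i) ≤
      Fintype.card ι * (∑' n : ℤ, r ^ n.natAbs) ^ Fintype.card ι * ∏ i, B i := by
  have hb : ∀ i n, b i n ≤ B i := by
    intro i n
    by_cases hi : q i = ∞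
    · exact htop i hi n
    · have := hfin i hi {n}
      rw [Finset.sum_singleton] at this
      exact (ENNReal.rpow_le_rpow_iff (ENNReal.toReal_pos (hq0 i).ne' hi)).1 this
  by_cases h0 : ∃ i, B i = 0
  · obtain ⟨i, hi⟩ := h0
    refine le_trans (le_of_eq (Finset.sum_eq_zero fun k _ => ?_)) zero_le
    rw [Finset.prod_eq_zero (Finset.mem_univ i), mul_zero]
    exact le_antisymm ((hb i _).trans_eq hi) zero_le
  push Not at h0
  have hne : Nonempty ι := by
    by_contra h
    rw [not_nonempty_iff] at h
    simp at hq
  by_cases h1 : ∃ i, B i = ∞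
  · obtain ⟨i, hi⟩ := h1
    -- The term n = 0 equals 1, so the right side is really ∞ rather than 0 · ∞.
    have hT : (∑' n : ℤ, r ^ n.natAbs) ≠ 0 := by
      rw [Ne, ENNReal.tsum_eq_zero]
      intro h
      simpa using h 0
    have : ∏ i, B i = ∞ := by
      rw [← Finset.mul_prod_erase _ _ (Finset.mem_univ i), hi, ENNReal.top_mul]
      exact Finset.prod_ne_zero_iff.2 fun j _ => h0 j
    rw [this, ENNReal.mul_top (by simp [hT])]
    exact le_top
  push Not at h1
  set c : ι → ℤ → ℝ≥0∞ := fun i n => b i n / B i with hc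
  have hc1 : ∀ i n, c i n ≤ 1 := fun i n => ENNReal.div_le_of_le_mul (by simpa using hb i n)
  have hbc : ∀ i n, b i n = c i n * B i := fun i n =>
    (ENNReal.div_mul_cancel (h0 i) (h1 i)).symm
  set g : ι → ℤ → ℝ≥0∞ := fun i n => if q i = ∞ then 0 else c i n ^ (q i).toReal with hg
  have hgsum : ∀ i, ∑ n ∈ S, g i n ≤ 1 := by
    intro i
    by_cases hi : q i = ∞
    · simp [hg, hi]
    have hpos := ENNReal.toReal_pos (hq0 i).ne' hi
    simp only [hg, if_neg hi, hc, ENNReal.div_rpow_of_nonneg _ _ hpos.le]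
    simp only [div_eq_mul_inv]
    rw [← Finset.sum_mul, ← div_eq_mul_inv]
    exact ENNReal.div_le_of_le_mul (by simpa using hfin i hi S)
  calc ∑ k ∈ Fintype.piFinset fun _ : ι => S, W k * ∏ i, b i (k i)
      = (∑ k ∈ Fintype.piFinset fun _ : ι => S, W k * ∏ i, c i (k i)) * ∏ i, B i := by
        simp only [hbc, Finset.prod_mul_distrib, ← mul_assoc, Finset.sum_mul]
    _ ≤ (∑ k ∈ Fintype.piFinset fun _ : ι => S, ∑ i, g i (k i) * ∏ j, r ^ (k j - k i).natAbs) *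
          ∏ i, B i := by
        gcongr with k
        -- The i-th term of the resulting sum is paired with the bound on W pivoted at the same i;
        -- hence `hW` for every pivot.
        refine (mul_le_mul_right (prod_le_sum_rpow hq0 hq fun i => hc1 i (k i)) _).trans ?_
        rw [Finset.mul_sum]
        refine Finset.sum_le_sum fun i _ => ?_
        rw [mul_comm]
        exact mul_le_mul_right (hW k i) _
    _ ≤ (∑ _i : ι, 1 * (∑' n : ℤ, r ^ n.natAbs) ^ Fintype.card ι) * ∏ i, B i := by
        rw [Finset.sum_comm]
        gcongr with i
        exact (sum_piFinset_mul_prod_le S i (g i) r).trans (mul_le_mul_left (hgsum i) _)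
    _ = _ := by simp

end Discrete

/-! ### Truncations by height in L¹ ∩ L^∞. -/

section Truncation

variable {𝕜 : Type*} [RCLike 𝕜] {ℓ : ℕ}

theorem L1Linf.memLp_one (a : L1Linf 𝕜 ℓ) :
    MemLp (a : EuclideanSpace ℝ (Fin ℓ) →ₘ[volume] 𝕜) 1 volume :=
  Lp.mem_Lp_iff_memLp.1 a.2.1

theorem L1Linf.memLp_top (a : L1Linf 𝕜 ℓ) :
    MemLp (a : EuclideanSpace ℝ (Fin ℓ) →ₘ[volume] 𝕜) ∞ volume :=
  Lp.mem_Lp_iff_memLp.1 a.2.2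

theorem L1Linf.measurableSet_lt_enorm (a : L1Linf 𝕜 ℓ) (s : ℝ≥0∞) :
    MeasurableSet {x | s < ‖(a : EuclideanSpace ℝ (Fin ℓ) →ₘ[volume] 𝕜) x‖ₑ} :=
  measurableSet_lt measurable_const (AEEqFun.stronglyMeasurable a.1).measurable.enorm

theorem L1Linf.memLp_indicator (a : L1Linf 𝕜 ℓ) (s p : ℝ≥0∞)
    (h : MemLp (a : EuclideanSpace ℝ (Fin ℓ) →ₘ[volume] 𝕜) p volume) :
    MemLp ({x | s < ‖(a : EuclideanSpace ℝ (Fin ℓ) →ₘ[volume] 𝕜) x‖ₑ}.indicator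
      (a : EuclideanSpace ℝ (Fin ℓ) →ₘ[volume] 𝕜)) p volume :=
  h.indicator (L1Linf.measurableSet_lt_enorm a s)

/-- The part of `a` above height `s`. -/
noncomputable def L1Linf.above (a : L1Linf 𝕜 ℓ) (s : ℝ≥0∞) : L1Linf 𝕜 ℓ :=
  ⟨AEEqFun.mk _ (L1Linf.memLp_indicator a s 1 (L1Linf.memLp_one a)).aestronglyMeasurable,
    (L1Linf.memLp_indicator a s 1 (L1Linf.memLp_one a)).eLpNorm_mk_lt_top,
    (L1Linf.memLp_indicator a s ∞ (L1Linf.memLp_top a)).eLpNorm_mk_lt_top⟩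

theorem L1Linf.coeFn_above (a : L1Linf 𝕜 ℓ) (s : ℝ≥0∞) :
    (L1Linf.above a s : EuclideanSpace ℝ (Fin ℓ) →ₘ[volume] 𝕜) =ᵐ[volume]
      {x | s < ‖(a : EuclideanSpace ℝ (Fin ℓ) →ₘ[volume] 𝕜) x‖ₑ}.indicator
        (a : EuclideanSpace ℝ (Fin ℓ) →ₘ[volume] 𝕜) :=
  AEEqFun.coeFn_mk _ _

theorem L1Linf.coeFn_sub (a b : L1Linf 𝕜 ℓ) :
    ((a - b : L1Linf 𝕜 ℓ) : EuclideanSpace ℝ (Fin ℓ) →ₘ[volume] 𝕜) =ᵐ[volume]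
      (a : EuclideanSpace ℝ (Fin ℓ) →ₘ[volume] 𝕜) - (b : EuclideanSpace ℝ (Fin ℓ) →ₘ[volume] 𝕜) :=
  AEEqFun.coeFn_sub _ _

theorem L1Linf.enorm_above_sub_above (a : L1Linf 𝕜 ℓ) {s t : ℝ≥0∞} (h : s ≤ t) :
    ∀ᵐ x, ‖((L1Linf.above a s - L1Linf.above a t : L1Linf 𝕜 ℓ) : EuclideanSpace ℝ (Fin ℓ) →ₘ[volume] 𝕜) x‖ₑ =
      {x | s < ‖(a : EuclideanSpace ℝ (Fin ℓ) →ₘ[volume] 𝕜) x‖ₑ ∧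
        ‖(a : EuclideanSpace ℝ (Fin ℓ) →ₘ[volume] 𝕜) x‖ₑ ≤ t}.indicator
          (fun x => ‖(a : EuclideanSpace ℝ (Fin ℓ) →ₘ[volume] 𝕜) x‖ₑ) x := by
  filter_upwards [L1Linf.coeFn_sub (L1Linf.above a s) (L1Linf.above a t),
    L1Linf.coeFn_above a s, L1Linf.coeFn_above a t]
    with x h1 h2 h3
  rw [h1, Pi.sub_apply, h2, h3]
  by_cases hs : s < ‖(a : EuclideanSpace ℝ (Fin ℓ) →ₘ[volume] 𝕜) x‖ₑ
  · by_cases ht : t < ‖(a : EuclideanSpace ℝ (Fin ℓ) →ₘ[volume] 𝕜) x‖ₑ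
    · simp [Set.indicator, hs, ht]
    · simp [Set.indicator, hs, ht, not_lt.1 ht]
  · have ht : ¬ t < ‖(a : EuclideanSpace ℝ (Fin ℓ) →ₘ[volume] 𝕜) x‖ₑ := fun h' => hs (h.trans_lt h')
    simp [Set.indicator, hs, ht]

/-- The part of `a` with values between `a*(2^(k+1))` and `a*(2^k)`. -/
noncomputable def L1Linf.dyadicPiece (a : L1Linf 𝕜 ℓ) (k : ℤ) : L1Linf 𝕜 ℓ :=
  L1Linf.above a (decreasingRearrangement (a : EuclideanSpace ℝ (Fin ℓ) →ₘ[volume] 𝕜) volume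
      (2 ^ ((k + 1 : ℤ) : ℝ))) -
    L1Linf.above a (decreasingRearrangement (a : EuclideanSpace ℝ (Fin ℓ) →ₘ[volume] 𝕜) volume
      (2 ^ (k : ℝ)))

/-- The part of `a` with values between `a*(2^N)` and `a*(2^(-N))`. -/
noncomputable def L1Linf.middle (a : L1Linf 𝕜 ℓ) (N : ℕ) : L1Linf 𝕜 ℓ :=
  L1Linf.above a (decreasingRearrangement (a : EuclideanSpace ℝ (Fin ℓ) →ₘ[volume] 𝕜) volume
      (2 ^ (N : ℝ))) -
    L1Linf.above a (decreasingRearrangement (a : EuclideanSpace ℝ (Fin ℓ) →ₘ[volume] 𝕜) volume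
      (2 ^ (-(N : ℝ))))

theorem L1Linf.sum_dyadicPiece (a : L1Linf 𝕜 ℓ) (N : ℕ) :
    ∑ k ∈ Finset.Ico (-N : ℤ) N, L1Linf.dyadicPiece a k = L1Linf.middle a N := by
  set F : ℤ → L1Linf 𝕜 ℓ := fun k => L1Linf.above a (decreasingRearrangement
    (a : EuclideanSpace ℝ (Fin ℓ) →ₘ[volume] 𝕜) volume (2 ^ (k : ℝ))) with hF
  -- Signs are arranged for the telescoping lemma `Finset.sum_Ico_int_sub`.
  have hpiece : ∀ k, L1Linf.dyadicPiece a k = -F k - -F (k + 1) := fun k => by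
    have h : ∀ x y : L1Linf 𝕜 ℓ, x - y = -y - -x := fun x y => by abel
    exact h _ _
  rw [Finset.sum_congr rfl fun k _ => hpiece k, Finset.sum_Ico_int_sub N fun k => -F k]
  have h : ∀ x y : L1Linf 𝕜 ℓ, -y - -x = x - y := fun x y => by abel
  refine (h _ _).trans ?_
  simp only [hF, middle]
  push_cast
  rfl

/-- Includes η = 0: the exponent is then ∞, whose `toReal` is 0, with inverse 0. -/
theorem toReal_one_div_ofReal_inv {η : ℝ} (hη : 0 ≤ η) :
    (1 / ENNReal.ofReal η).toReal⁻¹ = η := by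
  rw [one_div, ENNReal.toReal_inv, inv_inv, ENNReal.toReal_ofReal hη]

theorem L1Linf.eLpNorm_dyadicPiece_le (a : L1Linf 𝕜 ℓ) (k : ℤ) {η : ℝ} (hη : 0 ≤ η) :
    eLpNorm (L1Linf.dyadicPiece a k : EuclideanSpace ℝ (Fin ℓ) →ₘ[volume] 𝕜)
        (1 / ENNReal.ofReal η) volume ≤
      decreasingRearrangement (a : EuclideanSpace ℝ (Fin ℓ) →ₘ[volume] 𝕜) volume (2 ^ (k : ℝ)) *
        2 ^ (((k : ℝ) + 1) * η) := by
  set f := (a : EuclideanSpace ℝ (Fin ℓ) →ₘ[volume] 𝕜)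
  set M := decreasingRearrangement f volume (2 ^ (k : ℝ))
  set s := decreasingRearrangement f volume (2 ^ ((k + 1 : ℤ) : ℝ)) with hs
  have hsM : s ≤ M := decreasingRearrangement_antitone _
    (ENNReal.rpow_le_rpow_of_exponent_le (by norm_num) (by push_cast; linarith))
  have hle : eLpNorm (L1Linf.dyadicPiece a k : EuclideanSpace ℝ (Fin ℓ) →ₘ[volume] 𝕜)
      (1 / ENNReal.ofReal η) volume ≤
      eLpNorm ({x | s < ‖f x‖ₑ}.indicator fun _ => M) (1 / ENNReal.ofReal η) volume := by
    refine eLpNorm_mono_enorm_ae ?_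
    filter_upwards [L1Linf.enorm_above_sub_above a hsM] with x hx
    refine hx.trans_le ?_
    rw [enorm_eq_self]
    by_cases h1 : s < ‖f x‖ₑ
    · by_cases h2 : ‖f x‖ₑ ≤ M
      · rw [Set.indicator_of_mem (show x ∈ {x | s < ‖f x‖ₑ} from h1)]
        exact (Set.indicator_le_self _ _ _).trans h2
      · refine le_trans (le_of_eq (Set.indicator_of_notMem ?_ _)) zero_le
        exact fun h => h2 h.2
    · refine le_trans (le_of_eq (Set.indicator_of_notMem ?_ _)) zero_le
      exact fun h => h1 h.1
  refine hle.trans ?_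
  rw [eLpNorm_indicator_eq_eLpNorm_restrict (L1Linf.measurableSet_lt_enorm a s)]
  refine (eLpNorm_le_of_ae_enorm_bound (C := M) (by simp)).trans ?_
  rw [Measure.restrict_apply_univ, smul_eq_mul, toReal_one_div_ofReal_inv hη, ENNReal.rpow_mul]
  gcongr
  have := measure_decreasingRearrangement_lt_le (μ := volume) f (2 ^ ((k + 1 : ℤ) : ℝ))
  push_cast at this
  rw [hs]
  push_cast
  exact this

/-- Almost everywhere |a|^p ≤ ‖a‖_∞^(p-1) |a|. -/
theorem L1Linf.lintegral_rpow_enorm_ne_top (a : L1Linf 𝕜 ℓ) {p : ℝ} (hp : 1 ≤ p) :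
    ∫⁻ x, ‖(a : EuclideanSpace ℝ (Fin ℓ) →ₘ[volume] 𝕜) x‖ₑ ^ p ≠ ∞ := by
  set f := (a : EuclideanSpace ℝ (Fin ℓ) →ₘ[volume] 𝕜)
  set M := eLpNormEssSup f volume
  have hM : M ≠ ∞ := by simpa using (L1Linf.memLp_top a).eLpNorm_ne_top
  have h1 : ∫⁻ x, ‖f x‖ₑ ≠ ∞ := by
    rw [← eLpNorm_one_eq_lintegral_enorm]
    exact (L1Linf.memLp_one a).eLpNorm_ne_top
  have hle : ∫⁻ x, ‖f x‖ₑ ^ p ≤ ∫⁻ x, M ^ (p - 1) * ‖f x‖ₑ := by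
    refine lintegral_mono_ae ?_
    filter_upwards [enorm_ae_le_eLpNormEssSup f volume] with x hx
    calc ‖f x‖ₑ ^ p = ‖f x‖ₑ ^ (p - 1) * ‖f x‖ₑ ^ (1 : ℝ) := by
          rw [← ENNReal.rpow_add_of_nonneg _ _ (by linarith) zero_le_one]
          congr 1
          ring
      _ ≤ M ^ (p - 1) * ‖f x‖ₑ := by
          rw [ENNReal.rpow_one]
          gcongr
  refine ne_top_of_le_ne_top ?_ hle
  rw [lintegral_const_mul' _ _ (ENNReal.rpow_ne_top_of_nonneg (by linarith) hM)]
  exact ENNReal.mul_ne_top (ENNReal.rpow_ne_top_of_nonneg (by linarith) hM) h1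

theorem one_le_toReal_one_div_ofReal {θ : ℝ} (h0 : 0 < θ) (h1 : θ ≤ 1) :
    1 ≤ (1 / ENNReal.ofReal θ).toReal := by
  rw [one_div, ENNReal.toReal_inv, ENNReal.toReal_ofReal h0.le]
  exact (one_le_inv₀ h0).2 h1

theorem L1Linf.eLpNorm_ne_top (a : L1Linf 𝕜 ℓ) {θ : ℝ} (h0 : 0 < θ) (h1 : θ ≤ 1) :
    eLpNorm (a : EuclideanSpace ℝ (Fin ℓ) →ₘ[volume] 𝕜) (1 / ENNReal.ofReal θ) volume ≠ ∞ := by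
  rw [eLpNorm_eq_lintegral_rpow_enorm_toReal (by simp) (by simp [h0])]
  exact ENNReal.rpow_ne_top_of_nonneg (by positivity)
    (L1Linf.lintegral_rpow_enorm_ne_top a (one_le_toReal_one_div_ofReal h0 h1))

theorem L1Linf.enorm_middle_le (a : L1Linf 𝕜 ℓ) (N : ℕ) :
    ∀ᵐ x, ‖(L1Linf.middle a N : EuclideanSpace ℝ (Fin ℓ) →ₘ[volume] 𝕜) x‖ₑ ≤
      ‖(a : EuclideanSpace ℝ (Fin ℓ) →ₘ[volume] 𝕜) x‖ₑ := by
  have h : (-(N : ℝ)) ≤ N := by linarith [Nat.cast_nonneg (α := ℝ) N]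
  filter_upwards [L1Linf.enorm_above_sub_above a (decreasingRearrangement_antitone (μ := volume)
    (a : EuclideanSpace ℝ (Fin ℓ) →ₘ[volume] 𝕜)
    (ENNReal.rpow_le_rpow_of_exponent_le (x := 2) (by norm_num) h))] with x hx
  refine hx.trans_le (Set.indicator_le_self _ _ _)

theorem L1Linf.eLpNorm_middle_le (a : L1Linf 𝕜 ℓ) (N : ℕ) (p : ℝ≥0∞) :
    eLpNorm (L1Linf.middle a N : EuclideanSpace ℝ (Fin ℓ) →ₘ[volume] 𝕜) p volume ≤
      eLpNorm (a : EuclideanSpace ℝ (Fin ℓ) →ₘ[volume] 𝕜) p volume :=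
  eLpNorm_mono_enorm_ae (L1Linf.enorm_middle_le a N)

theorem L1Linf.coeFn_sub_middle (a : L1Linf 𝕜 ℓ) (N : ℕ) :
    ((a - L1Linf.middle a N : L1Linf 𝕜 ℓ) : EuclideanSpace ℝ (Fin ℓ) →ₘ[volume] 𝕜) =ᵐ[volume]
      {x | decreasingRearrangement (a : EuclideanSpace ℝ (Fin ℓ) →ₘ[volume] 𝕜) volume
          (2 ^ (N : ℝ)) < ‖(a : EuclideanSpace ℝ (Fin ℓ) →ₘ[volume] 𝕜) x‖ₑ ∧
        ‖(a : EuclideanSpace ℝ (Fin ℓ) →ₘ[volume] 𝕜) x‖ₑ ≤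
          decreasingRearrangement (a : EuclideanSpace ℝ (Fin ℓ) →ₘ[volume] 𝕜) volume
            (2 ^ (-(N : ℝ)))}ᶜ.indicator (a : EuclideanSpace ℝ (Fin ℓ) →ₘ[volume] 𝕜) := by
  set f := (a : EuclideanSpace ℝ (Fin ℓ) →ₘ[volume] 𝕜) with hf
  set s := decreasingRearrangement f volume (2 ^ (N : ℝ)) with hs
  set t := decreasingRearrangement f volume (2 ^ (-(N : ℝ))) with ht
  have hst : s ≤ t := by
    have h : (-(N : ℝ)) ≤ N := by linarith [Nat.cast_nonneg (α := ℝ) N]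
    exact decreasingRearrangement_antitone (μ := volume) f
      (ENNReal.rpow_le_rpow_of_exponent_le (x := 2) (by norm_num) h)
  filter_upwards [L1Linf.coeFn_sub a (L1Linf.middle a N), L1Linf.coeFn_sub (L1Linf.above a s) (L1Linf.above a t),
    L1Linf.coeFn_above a s, L1Linf.coeFn_above a t] with x h0 h1 h2 h3
  rw [h0, Pi.sub_apply]
  have h1' : (L1Linf.middle a N : EuclideanSpace ℝ (Fin ℓ) →ₘ[volume] 𝕜) x = _ := h1
  rw [h1', Pi.sub_apply, h2, h3]
  by_cases h4 : s < ‖f x‖ₑ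
  · by_cases h5 : t < ‖f x‖ₑ
    · simp [Set.indicator, h4, h5, ← hf]
    · simp [Set.indicator, h4, h5, not_lt.1 h5, ← hf]
  · have h5 : ¬ t < ‖f x‖ₑ := fun h' => h4 (hst.trans_lt h')
    simp [Set.indicator, h4, h5, ← hf]

/-- Dominated convergence under |a|^p: at almost every x the value |a(x)|, if nonzero, eventually
lies between the two truncation heights, and the remainder vanishes there. -/
theorem L1Linf.tendsto_eLpNorm_sub_middle (a : L1Linf 𝕜 ℓ) {θ : ℝ} (hθ0 : 0 < θ) (hθ1 : θ ≤ 1) :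
    Filter.Tendsto (fun N : ℕ => eLpNorm
      ((a - L1Linf.middle a N : L1Linf 𝕜 ℓ) : EuclideanSpace ℝ (Fin ℓ) →ₘ[volume] 𝕜)
        (1 / ENNReal.ofReal θ) volume) Filter.atTop (nhds 0) := by
  set f := (a : EuclideanSpace ℝ (Fin ℓ) →ₘ[volume] 𝕜) with hf
  set p := (1 / ENNReal.ofReal θ).toReal with hp
  have hp1 : 1 ≤ p := one_le_toReal_one_div_ofReal hθ0 hθ1
  have hp0 : 0 < p := by linarith
  simp only [eLpNorm_eq_lintegral_rpow_enorm_toReal (p := 1 / ENNReal.ofReal θ) (by simp)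
    (by simp [hθ0]), ← hp]
  have hall := ae_all_iff.2 fun N => L1Linf.coeFn_sub_middle a N
  have hlim : Filter.Tendsto (fun N : ℕ => ∫⁻ x, ‖((a - L1Linf.middle a N : L1Linf 𝕜 ℓ) :
      EuclideanSpace ℝ (Fin ℓ) →ₘ[volume] 𝕜) x‖ₑ ^ p) Filter.atTop
      (nhds (∫⁻ _x : EuclideanSpace ℝ (Fin ℓ), 0)) := by
    refine tendsto_lintegral_of_dominated_convergence (fun x => ‖f x‖ₑ ^ p) (fun N => ?_)
      (fun N => ?_) (L1Linf.lintegral_rpow_enorm_ne_top a hp1) ?_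
    · exact (AEEqFun.stronglyMeasurable _).measurable.enorm.pow_const p
    · filter_upwards [L1Linf.coeFn_sub_middle a N] with x hx
      rw [hx]
      gcongr
      exact enorm_indicator_le_enorm_self _ _
    · filter_upwards [hall, ae_exists_le_decreasingRearrangement f tendsto_two_rpow_neg_natCast]
        with x hx ⟨n, hn⟩
      refine tendsto_const_nhds.congr' ?_
      by_cases h0 : f x = 0
      · refine Filter.Eventually.of_forall fun N => ?_
        beta_reduce
        rw [hx N, Set.indicator_apply_eq_zero.2 fun _ => h0]
        simp [hp0]
      · filter_upwards [eventually_decreasingRearrangement_lt (L1Linf.memLp_one a)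
          tendsto_two_rpow_natCast h0, Filter.eventually_ge_atTop n] with N hN hnN
        rw [hx N, Set.indicator_of_notMem]
        · simp [hp0]
        · refine Set.notMem_compl_iff.2 ⟨hN, hn.trans (decreasingRearrangement_antitone f ?_)⟩
          exact ENNReal.rpow_le_rpow_of_exponent_le (by norm_num)
            (by simpa using (Nat.cast_le (α := ℝ)).2 hnN)
  rw [lintegral_zero] at hlim
  have := (ENNReal.continuous_rpow_const (y := 1 / p)).tendsto 0 |>.comp hlim
  rwa [ENNReal.zero_rpow_of_pos (by positivity)] at this

end Truncation

/-! ### Off-diagonal gain, summation and passage to the limit. -/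

section Interpolation

theorem exists_mem_ball_sum_mul_eq {m : ℕ} [Nonempty (Fin m)] (θ : EuclideanSpace ℝ (Fin m))
    {δ ε : ℝ} (hε : 0 ≤ ε) (hδ : 2 * ε < δ) (k : Fin m → ℤ) :
    ∃ η ∈ Metric.ball θ δ, ∃ i₀ j₀ : Fin m, (∀ i, k j₀ ≤ k i ∧ k i ≤ k i₀) ∧
      ∑ i, η i = ∑ i, θ i ∧
      ∑ i, (k i : ℝ) * η i = ∑ i, (k i : ℝ) * θ i - ε * (k i₀ - k j₀) := by
  obtain ⟨i₀, hi₀⟩ := Finite.exists_max k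
  obtain ⟨j₀, hj₀⟩ := Finite.exists_min k
  -- The shift has norm at most 2ε by the triangle inequality.
  refine ⟨θ + (EuclideanSpace.single j₀ ε - EuclideanSpace.single i₀ ε), ?_, i₀, j₀,
    fun i => ⟨hj₀ i, hi₀ i⟩, ?_, ?_⟩
  · rw [mem_ball_iff_norm, add_sub_cancel_left]
    refine (norm_sub_le _ _).trans_lt ?_
    rw [PiLp.norm_single, PiLp.norm_single, Real.norm_of_nonneg hε]
    linarith
  · simp [Finset.sum_add_distrib, Finset.sum_sub_distrib]
  · simp [mul_add, mul_sub, Finset.sum_add_distrib, Finset.sum_sub_distrib]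
    ring

/-- Each of the m distances to a pivot is at most the spread of k, so rate ε/m per coordinate is
affordable. The infimum serves all pivots with one weight. -/
theorem two_rpow_le_iInf_prod {m : ℕ} {ε : ℝ} (hε : 0 ≤ ε) (hm : 0 < m) {k : Fin m → ℤ}
    {i₀ j₀ : Fin m} (h : ∀ i, k j₀ ≤ k i ∧ k i ≤ k i₀) :
    (2 : ℝ≥0∞) ^ (-(ε * ((k i₀ : ℝ) - k j₀))) ≤
      ⨅ i, ∏ j, ((2 : ℝ≥0∞) ^ (-(ε / m))) ^ (k j - k i).natAbs := by
  refine le_iInf fun i => ?_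
  have hm' : (0 : ℝ) < m := Nat.cast_pos.2 hm
  simp only [← ENNReal.rpow_natCast, ← ENNReal.rpow_mul]
  rw [prod_two_rpow]
  refine ENNReal.rpow_le_rpow_of_exponent_le (by norm_num) ?_
  have hle : ∀ j, ((k j - k i).natAbs : ℝ) ≤ (k i₀ : ℝ) - k j₀ := by
    intro j
    have : ((k j - k i).natAbs : ℤ) ≤ k i₀ - k j₀ := by
      have := h i
      have := h j
      omega
    rw [← Int.cast_sub, ← Int.cast_natCast]
    exact Int.cast_le.2 this
  have hsum : ∑ j, ((k j - k i).natAbs : ℝ) ≤ m * ((k i₀ : ℝ) - k j₀) := by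
    refine (Finset.sum_le_sum fun j _ => hle j).trans_eq ?_
    rw [Finset.sum_const, Finset.card_univ, Fintype.card_fin, nsmul_eq_mul]
  rw [← Finset.mul_sum, neg_mul, neg_le_neg_iff]
  calc ε / m * ∑ j, ((k j - k i).natAbs : ℝ) ≤ ε / m * (m * ((k i₀ : ℝ) - k j₀)) := by gcongr
    _ = ε * ((k i₀ : ℝ) - k j₀) := by field_simp

variable {𝕜 : Type*} [RCLike 𝕜] {ℓ m : ℕ}

theorem enorm_map_dyadicPiece_le {θ : EuclideanSpace ℝ (Fin m)} {δ ε : ℝ} (hm : 0 < m)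
    (hε : 0 ≤ ε) (hδ : 2 * ε < δ)
    (hcube : Metric.ball θ δ ⊆ {η | ∀ i, η i ∈ Set.Icc (0 : ℝ) 1})
    (Λ : MultilinearMap 𝕜 (fun _ : Fin m => L1Linf 𝕜 ℓ) 𝕜) (A : ℝ≥0)
    (hΛ : ∀ η ∈ Metric.ball θ δ ∩ {η | ∑ i, η i = ∑ i, θ i}, ∀ a : Fin m → L1Linf 𝕜 ℓ,
      ‖Λ a‖ₑ ≤ A * ∏ i, eLpNorm (a i : EuclideanSpace ℝ (Fin ℓ) →ₘ[volume] 𝕜)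
        (1 / ENNReal.ofReal (η i)) volume)
    (a : Fin m → L1Linf 𝕜 ℓ) (k : Fin m → ℤ) :
    ‖Λ fun i => L1Linf.dyadicPiece (a i) (k i)‖ₑ ≤ A * 2 ^ (∑ i, θ i) *
      ((⨅ i, ∏ j, ((2 : ℝ≥0∞) ^ (-(ε / m))) ^ (k j - k i).natAbs) *
        ∏ i, dyadicRearrangement (a i : EuclideanSpace ℝ (Fin ℓ) →ₘ[volume] 𝕜) volume
          (θ i) (k i)) := by
  have : Nonempty (Fin m) := ⟨⟨0, hm⟩⟩
  obtain ⟨η, hη, i₀, j₀, hij, hsum, hksum⟩ := exists_mem_ball_sum_mul_eq θ hε hδ k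
  refine (hΛ η ⟨hη, hsum⟩ _).trans ?_
  rw [mul_assoc]
  gcongr (A : ℝ≥0∞) * ?_
  refine (Finset.prod_le_prod' fun i _ =>
    L1Linf.eLpNorm_dyadicPiece_le (a i) (k i) (hcube hη i).1).trans ?_
  have hexp : ∑ i, ((k i : ℝ) + 1) * η i =
      ∑ i, θ i + (-(ε * ((k i₀ : ℝ) - k j₀)) + ∑ i, (k i : ℝ) * θ i) := by
    simp only [add_mul, one_mul, Finset.sum_add_distrib, hsum, hksum]
    ring
  simp only [dyadicRearrangement]
  rw [Finset.prod_mul_distrib, Finset.prod_mul_distrib, prod_two_rpow, prod_two_rpow, hexp,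
    two_rpow_add, two_rpow_add]
  refine le_trans (le_of_eq ?_) (mul_le_mul_right
    (mul_le_mul_left (two_rpow_le_iInf_prod hε hm hij) _) _)
  ring

theorem enorm_map_middle_le {θ : EuclideanSpace ℝ (Fin m)} {δ ε : ℝ} {q : Fin m → ℝ≥0∞}
    (hm : 0 < m) (hε : 0 ≤ ε) (hδ : 2 * ε < δ)
    (hcube : Metric.ball θ δ ⊆ {η | ∀ i, η i ∈ Set.Icc (0 : ℝ) 1})
    (hq0 : ∀ i, 0 < q i) (hq : 1 ≤ ∑ i, 1 / q i)
    (Λ : MultilinearMap 𝕜 (fun _ : Fin m => L1Linf 𝕜 ℓ) 𝕜) (A : ℝ≥0)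
    (hΛ : ∀ η ∈ Metric.ball θ δ ∩ {η | ∑ i, η i = ∑ i, θ i}, ∀ a : Fin m → L1Linf 𝕜 ℓ,
      ‖Λ a‖ₑ ≤ A * ∏ i, eLpNorm (a i : EuclideanSpace ℝ (Fin ℓ) →ₘ[volume] 𝕜)
        (1 / ENNReal.ofReal (η i)) volume)
    (a : Fin m → L1Linf 𝕜 ℓ) (N : ℕ) :
    ‖Λ fun i => L1Linf.middle (a i) N‖ₑ ≤ A * 2 ^ (∑ i, θ i) *
      (m * (∑' n : ℤ, ((2 : ℝ≥0∞) ^ (-(ε / m))) ^ n.natAbs) ^ m *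
        ∏ i, (2 ^ (θ i + 1 / (q i).toReal) *
          eLorentzNorm (a i : EuclideanSpace ℝ (Fin ℓ) →ₘ[volume] 𝕜) (1 / θ i) (q i) volume)) := by
  have hθ : ∀ i, 0 ≤ θ i := fun i => (hcube (Metric.mem_ball_self (by linarith)) i).1
  simp only [← L1Linf.sum_dyadicPiece]
  rw [MultilinearMap.map_sum_finset]
  refine (enorm_sum_le _ _).trans ?_
  refine (Finset.sum_le_sum fun k _ =>
    enorm_map_dyadicPiece_le hm hε hδ hcube Λ A hΛ a k).trans ?_
  rw [← Finset.mul_sum]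
  gcongr (A : ℝ≥0∞) * 2 ^ (∑ i, θ i) * ?_
  have := sum_mul_prod_le_of_sum_rpow_le hq0 hq (Finset.Ico (-N : ℤ) N)
    (r := (2 : ℝ≥0∞) ^ (-(ε / m)))
    (W := fun k => ⨅ i, ∏ j, ((2 : ℝ≥0∞) ^ (-(ε / m))) ^ (k j - k i).natAbs)
    (fun k i => iInf_le _ i)
    (b := fun i n => dyadicRearrangement (a i : EuclideanSpace ℝ (Fin ℓ) →ₘ[volume] 𝕜) volume
      (θ i) n)
    (B := fun i => 2 ^ (θ i + 1 / (q i).toReal) *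
      eLorentzNorm (a i : EuclideanSpace ℝ (Fin ℓ) →ₘ[volume] 𝕜) (1 / θ i) (q i) volume)
    (fun i hi n => ?_)
    (fun i hi s => sum_dyadicRearrangement_rpow_le _ (hθ i) (hq0 i) hi s)
  · simpa only [Fintype.card_fin] using this
  · refine (dyadicRearrangement_le_eLorentzNorm_top _ _ _).trans ?_
    rw [hi]
    -- For q_i = ∞ the factor is superfluous but at least 1; it keeps one formula for all q_i.
    refine le_mul_of_one_le_left' ?_
    rw [← ENNReal.rpow_zero (x := 2)]
    exact ENNReal.rpow_le_rpow_of_exponent_le (by norm_num) (add_nonneg (hθ i) (by positivity))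

/-- Expand Λ multilinearly over a_i = middle + remainder. Every term but the all-middle one contains
a remainder, whose L^{1/θ_i} norm tends to 0 while the other factors stay bounded. -/
theorem enorm_map_le_of_forall_enorm_map_middle_le {θ : Fin m → ℝ}
    (hθ0 : ∀ i, 0 < θ i) (hθ1 : ∀ i, θ i ≤ 1)
    (Λ : MultilinearMap 𝕜 (fun _ : Fin m => L1Linf 𝕜 ℓ) 𝕜) (A : ℝ≥0)
    (hΛ : ∀ a : Fin m → L1Linf 𝕜 ℓ,
      ‖Λ a‖ₑ ≤ A * ∏ i, eLpNorm (a i : EuclideanSpace ℝ (Fin ℓ) →ₘ[volume] 𝕜)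
        (1 / ENNReal.ofReal (θ i)) volume)
    (a : Fin m → L1Linf 𝕜 ℓ) {R : ℝ≥0∞} (hR : ∀ N, ‖Λ fun i => L1Linf.middle (a i) N‖ₑ ≤ R) :
    ‖Λ a‖ₑ ≤ R := by
  set P : Finset (Fin m) → ℕ → ℝ≥0∞ := fun s N => A * ∏ i,
    if i ∈ s then eLpNorm (a i : EuclideanSpace ℝ (Fin ℓ) →ₘ[volume] 𝕜)
      (1 / ENNReal.ofReal (θ i)) volume
    else eLpNorm ((a i - L1Linf.middle (a i) N : L1Linf 𝕜 ℓ) :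
      EuclideanSpace ℝ (Fin ℓ) →ₘ[volume] 𝕜) (1 / ENNReal.ofReal (θ i)) volume with hP
  have hbound : ∀ N, ‖Λ a‖ₑ ≤ R + ∑ s ∈ Finset.univ.erase Finset.univ, P s N := by
    intro N
    have hsplit : a = (fun i => L1Linf.middle (a i) N) + fun i => a i - L1Linf.middle (a i) N := by
      funext i
      exact (add_sub_cancel (L1Linf.middle (a i) N) (a i)).symm
    conv_lhs => rw [hsplit]
    rw [MultilinearMap.map_add_univ, ← Finset.add_sum_erase _ _ (Finset.mem_univ Finset.univ)]
    refine (enorm_add_le _ _).trans (add_le_add ?_ ?_)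
    · rw [Finset.piecewise_univ]
      exact hR N
    · refine (enorm_sum_le _ _).trans (Finset.sum_le_sum fun s _ => (hΛ _).trans ?_)
      refine mul_le_mul_right (Finset.prod_le_prod' fun i _ => ?_) _
      by_cases hi : i ∈ s
      · rw [Finset.piecewise_eq_of_mem _ _ _ hi, if_pos hi]
        exact L1Linf.eLpNorm_middle_le (a i) N _
      · rw [Finset.piecewise_eq_of_notMem _ _ _ hi, if_neg hi]
  have hP0 : ∀ s ∈ Finset.univ.erase (Finset.univ : Finset (Fin m)),
      Filter.Tendsto (P s) Filter.atTop (nhds 0) := by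
    intro s hs
    obtain ⟨j, hj⟩ : ∃ j, j ∉ s := by
      by_contra h
      push Not at h
      exact (Finset.mem_erase.1 hs).1 (Finset.eq_univ_iff_forall.2 h)
    set Q : Fin m → ℝ≥0∞ := fun i => if i ∈ s then
      eLpNorm (a i : EuclideanSpace ℝ (Fin ℓ) →ₘ[volume] 𝕜) (1 / ENNReal.ofReal (θ i)) volume
      else 0 with hQ
    have hprod : ∏ i, Q i = 0 := Finset.prod_eq_zero (Finset.mem_univ j) (by simp [hQ, hj])
    -- Finite limits exclude 0 · ∞ in the limit of the product.
    have hQtop : ∀ i, Q i ≠ ∞ := by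
      intro i
      simp only [hQ]
      split_ifs
      · exact L1Linf.eLpNorm_ne_top (a i) (hθ0 i) (hθ1 i)
      · simp
    have key : Filter.Tendsto (fun N => ∏ i, if i ∈ s then
        eLpNorm (a i : EuclideanSpace ℝ (Fin ℓ) →ₘ[volume] 𝕜) (1 / ENNReal.ofReal (θ i)) volume
        else eLpNorm ((a i - L1Linf.middle (a i) N : L1Linf 𝕜 ℓ) :
          EuclideanSpace ℝ (Fin ℓ) →ₘ[volume] 𝕜) (1 / ENNReal.ofReal (θ i)) volume)
        Filter.atTop (nhds (∏ i, Q i)) := by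
      refine ENNReal.tendsto_finsetProd_of_ne_top _ (fun i _ => ?_) fun i _ => hQtop i
      by_cases hi : i ∈ s
      · simp [hQ, hi]
      · simpa [hQ, hi] using L1Linf.tendsto_eLpNorm_sub_middle (a i) (hθ0 i) (hθ1 i)
    have := ENNReal.Tendsto.const_mul key (a := (A : ℝ≥0∞)) (Or.inr ENNReal.coe_ne_top)
    rwa [hprod, mul_zero] at this
  have hlim := (tendsto_finsetSum _ hP0).const_add R
  rw [Finset.sum_const_zero, add_zero] at hlim
  exact ge_of_tendsto' hlim hbound

end Interpolation

/-! ### Assembling the constant. -/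

theorem pos_of_ball_subset {m : ℕ} {θ : EuclideanSpace ℝ (Fin m)} {δ : ℝ} (hδ : 0 < δ)
    (hcube : Metric.ball θ δ ⊆ {η | ∀ i, η i ∈ Set.Icc (0 : ℝ) 1}) (i : Fin m) : 0 < θ i := by
  have hmem : θ - EuclideanSpace.single i (δ / 2) ∈ Metric.ball θ δ := by
    rw [mem_ball_iff_norm, sub_sub_cancel_left, norm_neg, PiLp.norm_single,
      Real.norm_of_nonneg (by positivity)]
    linarith
  have := (hcube hmem i).1
  simp at this
  linarith

theorem mainTheorem7 (m : ℕ) (θ : EuclideanSpace ℝ (Fin m)) (K δ : ℝ) (q : Fin m → ℝ≥0∞)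
    (hδ : 0 < δ)
    (hcube : Metric.ball θ δ ⊆ {η | ∀ i, η i ∈ Set.Icc (0 : ℝ) 1})
    (hK : ∑ i, θ i = K)
    (hq_pos : ∀ i, 0 < q i)
    (hq : 1 ≤ ∑ i, 1 / q i) :
    ∃ C : ℝ≥0, ∀ (𝕜 : Type*) [RCLike 𝕜] (ℓ : ℕ)
      (Λ : MultilinearMap 𝕜 (fun _ : Fin m => L1Linf 𝕜 ℓ) 𝕜) (A : ℝ≥0),
      (∀ η ∈ Metric.ball θ δ ∩ {η | ∑ i, η i = K}, ∀ a : Fin m → L1Linf 𝕜 ℓ,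
        ‖Λ a‖ₑ ≤ A * ∏ i, eLpNorm (a i : EuclideanSpace ℝ (Fin ℓ) →ₘ[volume] 𝕜)
          (1 / ENNReal.ofReal (η i)) volume) →
      ∀ a : Fin m → L1Linf 𝕜 ℓ,
        ‖Λ a‖ₑ ≤ C * A * ∏ i, eLorentzNorm (a i : EuclideanSpace ℝ (Fin ℓ) →ₘ[volume] 𝕜)
          (1 / θ i) (q i) volume := by
  subst hK
  have hm : 0 < m := by
    rcases Nat.eq_zero_or_pos m with rfl | h
    · simp at hq
    · exact h
  have hθ0 := pos_of_ball_subset hδ hcube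
  have hθ1 : ∀ i, θ i ≤ 1 := fun i => (hcube (Metric.mem_ball_self hδ) i).2
  -- The choice ε = δ/3 satisfies 2ε < δ, and ε > 0 makes the geometric series converge.
  have hr : (2 : ℝ≥0∞) ^ (-(δ / 3 / m)) < 1 :=
    ENNReal.rpow_lt_one_of_one_lt_of_neg (by norm_num) (by
      have : (0 : ℝ) < m := Nat.cast_pos.2 hm
      have : 0 < δ / 3 / m := by positivity
      linarith)
  set C : ℝ≥0∞ := 2 ^ (∑ i, θ i) *
    (m * (∑' n : ℤ, ((2 : ℝ≥0∞) ^ (-(δ / 3 / m))) ^ n.natAbs) ^ m *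
      ∏ i, 2 ^ (θ i + 1 / (q i).toReal)) with hC
  have hCtop : C ≠ ∞ := by
    refine ENNReal.mul_ne_top (two_rpow_ne_top _) (ENNReal.mul_ne_top (ENNReal.mul_ne_top
      (ENNReal.natCast_ne_top m) (ENNReal.pow_ne_top (tsum_int_pow_natAbs_ne_top hr))) ?_)
    exact ENNReal.prod_ne_top fun i _ => two_rpow_ne_top _
  refine ⟨C.toNNReal, fun 𝕜 _ ℓ Λ A hΛ a => ?_⟩
  rw [ENNReal.coe_toNNReal hCtop]
  refine enorm_map_le_of_forall_enorm_map_middle_le hθ0 hθ1 Λ A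
    (hΛ θ ⟨Metric.mem_ball_self hδ, rfl⟩) a fun N => ?_
  refine (enorm_map_middle_le (ε := δ / 3) hm (by positivity) (by linarith) hcube hq_pos hq Λ A hΛ
    a N).trans (le_of_eq ?_)
  rw [Finset.prod_mul_distrib, hC]
  ring
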